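/- Let $\Omega=\{0,1\}^{\mathbb N}$ be the space of infinite binary sequences with the product topology and its Borel $\sigma$-algebra, and let $T\colon\Omega\to\Omega$ be the left shift, $\omega(1)\omega(2)\omega(3)\ldots\mapsto\omega(2)\omega(3)\ldots$. A Borel probability measure $P$ on $\Omega$ is called stationary if $P(T^{-1}(A))=P(A)$ for every Borel set $A\subseteq\Omega$. A stationary measure $P$ is called ergodic if $P(A)\in\{0,1\}$ for every Borel set $A$ with $T^{-1}(A)=A$ (equivalently, for a stationary $P$, for every Borel set $A$ with $T(A)\subseteq A$). For a finite binary word $y$ let $P(y)$ be the $P$-measure of the set of all sequences that begin with $y$. A basic set of measures is a set of Borel probability measures on $\Omega$ that is defined by a finite list of conditions of the form $u<P(y)<v$, where $y$ is a finite binary word and $u,v$ are rational numbers. A class $\mathcal C$ of Borel probability measures on $\Omega$ is called effectively compact if it is compact (in the topology generated by the basic sets, which is the topology of weak convergence) and the set of all finite families of basic sets that cover $\mathcal C$ is computably enumerable (each family being given by the finite lists of conditions that define its members). Theorem. There exists an ergodic stationary measure $P$ on $\Omega$ that does not belong to any effectively compact class $\mathcal C$ all of whose elements are ergodic stationary measures.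 -/

import Mathlib

open MeasureTheory

namespace BinarySequence

/-- The Cantor space `Ω` of infinite binary sequences, with its product topology and its
Borel (equivalently, product) σ-algebra. -/
abbrev Omega : Type := ℕ → Bool

/-- The left shift `T : ω(0)ω(1)ω(2)… ↦ ω(1)ω(2)…`. -/
def shift (ω : Omega) : Omega := fun n => ω (n + 1)

/-- The interval `xΩ`: all infinite sequences that begin with the word `x`. -/
def interval (x : List Bool) : Set Omega :=
  {ω | ∀ (i : ℕ) (h : i < x.length), ω i = x[i]}

/-- A code `(p, q)` of a rational number, which denotes `p / (q + 1)`. -/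
abbrev RatCode : Type := ℤ × ℕ

/-- The rational number denoted by a code. -/
def RatCode.value (c : RatCode) : ℚ := (c.1 : ℚ) / ((c.2 : ℚ) + 1)

/-- A condition `u < P(y) < v` on a measure `P`, given as `(y, u, v)` with `y` a binary word
and `u`, `v` (codes of) rational numbers. -/
abbrev Condition : Type := List Bool × RatCode × RatCode

/-- The measure `P` satisfies the condition `u < P(y) < v`, where `P(y)` is the measure of the
interval of the word `y`. -/
def Condition.Holds (c : Condition) (P : ProbabilityMeasure Omega) : Prop :=
  (RatCode.value c.2.1 : ℝ) < (P : Measure Omega).real (interval c.1) ∧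
    (P : Measure Omega).real (interval c.1) < (RatCode.value c.2.2 : ℝ)

/-- A code of a basic set of measures: a finite list of conditions. -/
abbrev BasicCode : Type := List Condition

/-- The basic set of measures with a given code: all probability measures that satisfy all the
conditions of the list. -/
def basicSet (b : BasicCode) : Set (ProbabilityMeasure Omega) :=
  {P | ∀ c ∈ b, Condition.Holds c P}

/-- The finite family of basic sets coded by the list `S` covers the class `C`. -/
def Covers (S : List BasicCode) (C : Set (ProbabilityMeasure Omega)) : Prop :=
  ∀ P ∈ C, ∃ b ∈ S, P ∈ basicSet b

/-- A class of measures is effectively compact if it is compact and the set of all finite families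
of basic sets that cover it is computably enumerable. The space of measures carries the topology
of weak convergence, which on the Cantor space is the topology generated by the basic sets. -/
def IsEffectivelyCompact (C : Set (ProbabilityMeasure Omega)) : Prop :=
  IsCompact C ∧ REPred fun S : List BasicCode => Covers S C

end BinarySequence

namespace BinarySequence

open Filter Topology Set ProbabilityTheory

/-! ### Recursively enumerable predicates and effectively compact classes are countable -/

/-! The proof is a Baire category argument; effectiveness matters only through countability. A
compact class is determined by the finite families of basic sets that cover it
(`subset_of_forall_covers`), and there are countably many enumerable predicates, so there are
countably many effectively compact classes.

Let K be the closure of the set of uniform measures on periodic orbits, a compact space. Ergodicity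
is generic in K: it follows from countably many open conditions, each saying that some Birkhoff
average has small variance, and periodic orbit measures satisfy all of them
(`ergodic_of_mem_closure_periodicMeasures`). Nonergodic measures are dense in K: mixing a periodic
orbit measure with a little mass at a constant sequence destroys ergodicity, yet the mixture is
again a limit of periodic orbit measures (`tendsto_orbitMeasure_padded`, `not_ergodic_mixture`).
Hence a closed class of ergodic measures has a dense open complement in K, and Baire's theorem
yields an ergodic measure outside all the classes at once. -/

theorem countable_setOf_rePred {α : Type*} [Primcodable α] :
    {p : α → Prop | REPred p}.Countable := by
  let dom : Nat.Partrec.Code → α → Prop := fun c a => (c.eval (Encodable.encode a)).Dom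
  refine (countable_range dom).mono fun p hp => ?_
  obtain ⟨c, hc⟩ := Nat.Partrec.Code.exists_code.1 hp
  refine ⟨c, funext fun a => ?_⟩
  simp [dom, hc, Part.assert, Part.bind]

theorem isClopen_interval (x : List Bool) : IsClopen (interval x) := by
  have : interval x = ⋂ i : Fin x.length, (fun ω : Omega => ω i) ⁻¹' {x[i]} := by
    ext ω
    simp [interval, Fin.forall_iff]
  rw [this]
  exact isClopen_iInter_of_finite fun i => (isClopen_discrete _).preimage (continuous_apply _)

theorem continuous_real_of_isClopen {B : Set Omega} (hB : IsClopen B) :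
    Continuous fun P : ProbabilityMeasure Omega => (P : Measure Omega).real B := by
  refine continuous_iff_continuousAt.2 fun P => ?_
  have := ProbabilityMeasure.tendsto_measure_of_isClopen_of_tendsto (tendsto_id (x := 𝓝 P)) hB
  exact (NNReal.continuous_coe.tendsto _).comp this

theorem isOpen_basicSet_singleton (c : Condition) : IsOpen (basicSet [c]) := by
  have h := continuous_real_of_isClopen (isClopen_interval c.1)
  have : basicSet [c] = {P | Condition.Holds c P} := by simp [basicSet]
  rw [this]
  exact (isOpen_lt continuous_const h).inter (isOpen_lt h continuous_const)

theorem RatCode.exists_value_eq (q : ℚ) : ∃ c : RatCode, c.value = q := by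
  -- A code `(p, n)` denotes `p / (n + 1)`, hence the shifted denominator.
  refine ⟨(q.num, q.den - 1), ?_⟩
  have h : ((q.den - 1 : ℕ) : ℚ) + 1 = q.den := by
    have := q.den_pos
    exact_mod_cast Nat.sub_add_cancel this
  simp only [RatCode.value]
  rw [h, Rat.num_div_den]

theorem exists_condition_of_real_ne {P Q : ProbabilityMeasure Omega} {x : List Bool}
    (h : (P : Measure Omega).real (interval x) ≠ (Q : Measure Omega).real (interval x)) :
    ∃ c : Condition, c.Holds Q ∧ ¬ c.Holds P := by
  have key : ∀ a b : ℝ, a ≠ b → ∃ u v : ℚ, (u < b ∧ b < v) ∧ ¬ (u < a ∧ a < v) := by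
    intro a b hab
    rcases lt_or_gt_of_ne hab with hab | hab
    · obtain ⟨u, hu, hu'⟩ := exists_rat_btwn hab
      obtain ⟨v, hv⟩ := exists_rat_gt b
      exact ⟨u, v, ⟨hu', hv⟩, fun h => absurd h.1 (not_lt.2 hu.le)⟩
    · obtain ⟨v, hv, hv'⟩ := exists_rat_btwn hab
      obtain ⟨u, hu⟩ := exists_rat_lt b
      exact ⟨u, v, ⟨hu, hv⟩, fun h => absurd h.2 (not_lt.2 hv'.le)⟩
  obtain ⟨u, v, h1, h2⟩ := key _ _ h
  obtain ⟨cu, rfl⟩ := RatCode.exists_value_eq u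
  obtain ⟨cv, rfl⟩ := RatCode.exists_value_eq v
  exact ⟨(x, cu, cv), h1, h2⟩

/-! ### Sets depending on finitely many coordinates -/

/-- The set of sequences whose first `k` terms form an element of `S`. -/
def prefixSet (k : ℕ) (S : Set (Fin k → Bool)) : Set Omega :=
  (fun (ω : Omega) (i : Fin k) => ω i) ⁻¹' S

/-- The family of all sets of sequences that are determined by finitely many coordinates. -/
def prefixSets : Set (Set Omega) := {B | ∃ k S, B = prefixSet k S}

theorem mem_prefixSets_of_forall {B : Set Omega} (k : ℕ)
    (h : ∀ ω ω' : Omega, (∀ i < k, ω i = ω' i) → ω ∈ B → ω' ∈ B) : B ∈ prefixSets := by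
  refine ⟨k, {s | ∃ ω ∈ B, ∀ i : Fin k, ω i = s i}, ?_⟩
  ext ω
  constructor
  · exact fun hω => ⟨ω, hω, fun _ => rfl⟩
  · rintro ⟨ω', hω', h'⟩
    exact h ω' ω (fun i hi => h' ⟨i, hi⟩) hω'

theorem mem_prefixSet_of_forall {k : ℕ} {S : Set (Fin k → Bool)} {ω ω' : Omega}
    (h : ∀ i < k, ω i = ω' i) (hω : ω ∈ prefixSet k S) : ω' ∈ prefixSet k S := by
  have : (fun i : Fin k => ω i) = fun i : Fin k => ω' i := funext fun i => h i i.2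
  simpa [prefixSet, this] using hω

theorem isPiSystem_prefixSets : IsPiSystem prefixSets := by
  rintro _ ⟨k, S, rfl⟩ _ ⟨l, R, rfl⟩ -
  refine mem_prefixSets_of_forall (max k l) fun ω ω' h hω => ⟨?_, ?_⟩
  · exact mem_prefixSet_of_forall (fun i hi => h i (lt_max_of_lt_left hi)) hω.1
  · exact mem_prefixSet_of_forall (fun i hi => h i (lt_max_of_lt_right hi)) hω.2

theorem isClopen_prefixSet (k : ℕ) (S : Set (Fin k → Bool)) : IsClopen (prefixSet k S) :=
  (isClopen_discrete S).preimage (by fun_prop)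

theorem measurableSet_prefixSet (k : ℕ) (S : Set (Fin k → Bool)) :
    MeasurableSet (prefixSet k S) :=
  (isClopen_prefixSet k S).isOpen.measurableSet

theorem generateFrom_prefixSets :
    (inferInstance : MeasurableSpace Omega) = MeasurableSpace.generateFrom prefixSets := by
  apply le_antisymm
  · refine iSup_le fun i => ?_
    rintro _ ⟨S, -, rfl⟩
    refine MeasurableSpace.measurableSet_generateFrom (mem_prefixSets_of_forall (i + 1) ?_)
    intro ω ω' h hω
    simpa [← h i (Nat.lt_succ_self i)] using hω
  · refine MeasurableSpace.generateFrom_le ?_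
    rintro _ ⟨k, S, rfl⟩
    exact measurableSet_prefixSet k S

theorem exists_prefixSets_subset {U : Set Omega} (hU : IsOpen U) {ω : Omega} (hω : ω ∈ U) :
    ∃ B ∈ prefixSets, B ∈ 𝓝 ω ∧ B ⊆ U := by
  obtain ⟨I, u, hu, hIU⟩ := isOpen_pi_iff.1 hU ω hω
  obtain ⟨k, hk⟩ : ∃ k, ∀ i ∈ I, i < k :=
    ⟨I.sup id + 1, fun i hi => Nat.lt_succ_of_le (Finset.le_sup (f := id) hi)⟩
  refine ⟨prefixSet k {s | ∀ i : Fin k, ω i = s i}, ⟨k, _, rfl⟩,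
    (isClopen_prefixSet _ _).isOpen.mem_nhds fun _ => rfl, fun ω' h => hIU fun i hi => ?_⟩
  have : ω i = ω' i := h ⟨i, hk i hi⟩
  exact this ▸ (hu i hi).2

theorem tendsto_of_forall_prefixSet {ι : Type*} {l : Filter ι} [l.IsCountablyGenerated]
    {P : ι → ProbabilityMeasure Omega} {Q : ProbabilityMeasure Omega}
    (h : ∀ k S, Tendsto (fun i => (P i : Measure Omega).real (prefixSet k S)) l
      (𝓝 ((Q : Measure Omega).real (prefixSet k S)))) : Tendsto P l (𝓝 Q) := by
  refine isPiSystem_prefixSets.tendsto_probabilityMeasure_of_tendsto_of_mem ?_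
    (fun U hU ω hω => exists_prefixSets_subset hU hω) ?_
  · rintro _ ⟨k, S, rfl⟩
    exact measurableSet_prefixSet k S
  · rintro _ ⟨k, S, rfl⟩
    exact NNReal.tendsto_coe.1 (h k S)

theorem isPiSystem_range_interval :
    IsPiSystem (range interval) := by
  rintro _ ⟨x, rfl⟩ _ ⟨y, rfl⟩ ⟨ω, hx, hy⟩
  refine ⟨List.ofFn fun i : Fin (max x.length y.length) => ω i, ?_⟩
  simp only [interval, mem_ofPred_eq] at hx hy
  ext ω'
  simp only [interval, mem_ofPred_eq, mem_inter_iff, List.length_ofFn, List.getElem_ofFn]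
  constructor
  · intro h
    exact ⟨fun i hi => (h i (lt_max_of_lt_left hi)).trans (hx i hi),
      fun i hi => (h i (lt_max_of_lt_right hi)).trans (hy i hi)⟩
  · rintro ⟨h1, h2⟩ i hi
    rcases lt_max_iff.1 hi with hi | hi
    · exact (h1 i hi).trans (hx i hi).symm
    · exact (h2 i hi).trans (hy i hi).symm

theorem prefixSet_eq_biUnion (k : ℕ) (S : Set (Fin k → Bool)) :
    prefixSet k S = ⋃ s ∈ S, interval (List.ofFn s) := by
  ext ω
  simp only [prefixSet, interval, mem_preimage, mem_iUnion, mem_ofPred_eq, List.length_ofFn,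
    List.getElem_ofFn, exists_prop]
  constructor
  · exact fun h => ⟨_, h, fun i hi => rfl⟩
  · rintro ⟨s, hs, h⟩
    convert hs with i
    exact h i i.2

theorem eq_of_forall_real_interval {P Q : ProbabilityMeasure Omega}
    (h : ∀ x, (P : Measure Omega).real (interval x) = (Q : Measure Omega).real (interval x)) :
    P = Q := by
  have hgen : (inferInstance : MeasurableSpace Omega) =
      MeasurableSpace.generateFrom (range interval) := by
    apply le_antisymm
    · rw [generateFrom_prefixSets]
      refine MeasurableSpace.generateFrom_le ?_
      rintro _ ⟨k, S, rfl⟩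
      rw [prefixSet_eq_biUnion]
      exact MeasurableSet.biUnion (to_countable S) fun s _ =>
        MeasurableSpace.measurableSet_generateFrom ⟨_, rfl⟩
    · refine MeasurableSpace.generateFrom_le ?_
      rintro _ ⟨x, rfl⟩
      exact (isClopen_interval x).isOpen.measurableSet
  refine Subtype.ext (ext_of_generate_finite (μ := (P : Measure Omega)) (ν := Q) _ hgen
    isPiSystem_range_interval ?_ ?_)
  · rintro _ ⟨x, rfl⟩
    exact (measureReal_eq_measureReal_iff).1 (h x)
  · simp

/-- If `P ∈ C \ C'`, each `Q ∈ C'` satisfies a single condition that fails for `P`. By compactness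
finitely many of these conditions cover `C'`, and that family misses `P`. -/
theorem subset_of_forall_covers {C C' : Set (ProbabilityMeasure Omega)} (hC' : IsCompact C')
    (h : ∀ S, Covers S C' → Covers S C) : C ⊆ C' := by
  intro P hP
  by_contra hPC
  have hsep : ∀ Q ∈ C', ∃ c : Condition, c.Holds Q ∧ ¬ c.Holds P := by
    intro Q hQ
    by_contra! hne
    refine hPC ?_
    convert hQ
    refine eq_of_forall_real_interval fun x => ?_
    by_contra hx
    obtain ⟨c, hcQ, hcP⟩ := exists_condition_of_real_ne hx
    exact hcP (hne c hcQ)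
  let good : Set Condition := {c | ¬ c.Holds P}
  obtain ⟨t, ht⟩ := hC'.elim_finite_subcover (fun c : good => basicSet [c.1])
    (fun c => isOpen_basicSet_singleton c.1) fun Q hQ => by
      obtain ⟨c, hcQ, hcP⟩ := hsep Q hQ
      exact mem_iUnion.2 ⟨⟨c, hcP⟩, by simpa [basicSet] using hcQ⟩
  obtain ⟨b, hb, hPb⟩ := h (t.toList.map fun c => [c.1]) (fun Q hQ => by
    obtain ⟨c, hc, hQc⟩ := mem_iUnion₂.1 (ht hQ)
    exact ⟨[c.1], List.mem_map.2 ⟨c, Finset.mem_toList.2 hc, rfl⟩, hQc⟩) P hP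
  obtain ⟨c, -, rfl⟩ := List.mem_map.1 hb
  exact c.2 (hPb c.1 (List.mem_singleton_self _))

theorem countable_setOf_isEffectivelyCompact :
    {C : Set (ProbabilityMeasure Omega) | IsEffectivelyCompact C}.Countable := by
  refine MapsTo.countable_of_injOn (f := fun C S => Covers S C) (fun C hC => hC.2) ?_
    (countable_setOf_rePred (α := List BasicCode))
  intro C hC C' hC' heq
  have h : ∀ S, Covers S C ↔ Covers S C' := fun S => iff_of_eq (congrFun heq S)
  exact (subset_of_forall_covers hC'.1 fun S => (h S).2).antisymm
    (subset_of_forall_covers hC.1 fun S => (h S).1)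

/-! ### A criterion for ergodicity -/

section Criterion

variable {X : Type*} [MeasurableSpace X] {μ : Measure X} [IsProbabilityMeasure μ] {T : X → X}

theorem memLp_indicator_one {A : Set X} (hA : MeasurableSet A) :
    MemLp (A.indicator (1 : X → ℝ)) 2 μ :=
  memLp_indicator_const 2 hA 1 (Or.inr (measure_ne_top μ A))

theorem memLp_birkhoffAverage_indicator (hT : MeasurePreserving T μ μ) {B : Set X}
    (hB : MeasurableSet B) (n : ℕ) :
    MemLp (birkhoffAverage ℝ T (B.indicator (1 : X → ℝ)) n) 2 μ := by
  have h : MemLp (fun x => ∑ i ∈ Finset.range n, B.indicator (1 : X → ℝ) (T^[i] x)) 2 μ :=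
    memLp_finsetSum _ fun i _ =>
      (memLp_indicator_one hB).comp_measurePreserving (hT.iterate i)
  exact h.const_smul ((n : ℝ)⁻¹)

/-- Invariance of `A` turns `T⁻ⁱ B ∩ A` into `T⁻ⁱ (A ∩ B)`, so all terms of the average have the
same integral. The empty average is 0, hence `n ≠ 0`. -/
theorem setIntegral_birkhoffAverage_indicator (hT : MeasurePreserving T μ μ) {A B : Set X}
    (hA : MeasurableSet A) (hB : MeasurableSet B) (hAT : T ⁻¹' A = A) {n : ℕ} (hn : n ≠ 0) :
    ∫ x in A, birkhoffAverage ℝ T (B.indicator (1 : X → ℝ)) n x ∂μ = μ.real (A ∩ B) := by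
  have hi : ∀ i, ∫ x in A, B.indicator (1 : X → ℝ) (T^[i] x) ∂μ = μ.real (A ∩ B) := by
    intro i
    have hTi := hT.iterate i
    have h1 : (fun x => B.indicator (1 : X → ℝ) (T^[i] x)) = (T^[i] ⁻¹' B).indicator 1 := rfl
    have h2 : T^[i] ⁻¹' B ∩ A = T^[i] ⁻¹' (A ∩ B) := by
      have : T^[i] ⁻¹' A = A := by
        rw [preimage_iterate_eq]
        exact Function.iterate_fixed hAT i
      rw [preimage_inter, this, inter_comm]
    rw [h1, integral_indicator_one (hTi.measurable hB), measureReal_restrict_apply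
      (hTi.measurable hB), h2, hTi.measureReal_preimage (hA.inter hB).nullMeasurableSet]
  have hfi : ∀ i ∈ Finset.range n,
      Integrable (fun x => B.indicator (1 : X → ℝ) (T^[i] x)) (μ.restrict A) := fun i _ =>
    (((memLp_indicator_one hB).comp_measurePreserving (hT.iterate i)).integrable
      one_le_two).restrict
  simp only [birkhoffAverage, birkhoffSum, smul_eq_mul]
  rw [integral_const_mul, integral_finsetSum _ hfi]
  simp only [hi, Finset.sum_const, Finset.card_range, nsmul_eq_mul]
  field_simp

theorem sq_sub_le_variance_birkhoffAverage (hT : MeasurePreserving T μ μ) {A B : Set X}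
    (hA : MeasurableSet A) (hB : MeasurableSet B) (hAT : T ⁻¹' A = A) {n : ℕ} (hn : n ≠ 0) :
    (μ.real (A ∩ B) - μ.real A * μ.real B) ^ 2 ≤
      Var[birkhoffAverage ℝ T (B.indicator (1 : X → ℝ)) n; μ] := by
  set g := birkhoffAverage ℝ T (B.indicator (1 : X → ℝ)) n with hg
  have hgL : MemLp g 2 μ := memLp_birkhoffAverage_indicator hT hB n
  have hmean : ∫ x, g x ∂μ = μ.real B := by
    have := setIntegral_birkhoffAverage_indicator hT MeasurableSet.univ hB preimage_univ hn
    simpa using this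
  set d := μ.real (A ∩ B) - μ.real A * μ.real B with hd
  have hAL : MemLp (A.indicator (1 : X → ℝ)) 2 μ := memLp_indicator_one hA
  have hcov : cov[g, A.indicator (1 : X → ℝ); μ] = d := by
    rw [covariance_eq_sub hgL hAL, hmean, integral_indicator_one hA]
    have : g * A.indicator 1 = A.indicator g := by
      ext x
      by_cases hx : x ∈ A <;> simp [hx]
    rw [this, integral_indicator hA, setIntegral_birkhoffAverage_indicator hT hA hB hAT hn, hd]
    ring
  have hvarA : Var[A.indicator (1 : X → ℝ); μ] ≤ 1 := by
    refine (variance_le_expectation_sq hAL.aestronglyMeasurable).trans ?_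
    have : (A.indicator (1 : X → ℝ)) ^ 2 = A.indicator 1 := by
      ext x
      by_cases hx : x ∈ A <;> simp [hx]
    rw [this, integral_indicator_one hA]
    exact measureReal_le_one
  -- Cauchy–Schwarz by hand: expanding gives `0 ≤ Var g - 2d² + d² Var 1_A`, and `Var 1_A ≤ 1`.
  have h0 := variance_nonneg (g - d • A.indicator (1 : X → ℝ)) μ
  rw [variance_sub hgL (hAL.const_smul d), variance_smul, covariance_smul_right, hcov] at h0
  nlinarith [sq_nonneg d]

/-- Small variances make an invariant `A` independent of every set in `π`, hence of every measurable
set, hence of itself: `μ A = (μ A)²`. One `n` for each `ε` is enough, so no ergodic theorem is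
needed and the criterion is a countable intersection of open conditions for the shift. -/
theorem ergodic_of_forall_exists_variance_lt (hT : MeasurePreserving T μ μ) {π : Set (Set X)}
    (hgen : (inferInstance : MeasurableSpace X) = MeasurableSpace.generateFrom π)
    (hpi : IsPiSystem π) (h : ∀ B ∈ π, ∀ ε > 0, ∃ n ≠ 0,
      Var[birkhoffAverage ℝ T (B.indicator (1 : X → ℝ)) n; μ] < ε) : Ergodic T μ := by
  refine ⟨hT, ⟨fun A hA hAT => ?_⟩⟩
  have hπ : ∀ B ∈ π, MeasurableSet B := fun B hB => by
    have := MeasurableSpace.measurableSet_generateFrom hB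
    rwa [← hgen] at this
  have hmul : ∀ B ∈ π, μ.real (A ∩ B) = μ.real A * μ.real B := by
    intro B hB
    by_contra hne
    obtain ⟨n, hn, hlt⟩ := h B hB _ (pow_pos (abs_pos.2 (sub_ne_zero.2 hne)) 2)
    rw [sq_abs] at hlt
    exact absurd (sq_sub_le_variance_birkhoffAverage hT hA (hπ B hB) hAT hn) (not_le.2 hlt)
  have heq : μ.restrict A = μ A • μ := by
    refine ext_of_generate_finite π hgen hpi (fun B hB => ?_) (by simp)
    rw [← measureReal_eq_measureReal_iff (h₂ := ENNReal.mul_ne_top (measure_ne_top μ A)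
      (measure_ne_top μ B)), measureReal_restrict_apply (hπ B hB), inter_comm, hmul B hB]
    simp [measureReal_def]
  have hA2 : μ.real A = μ.real A * μ.real A := by
    have := congrArg (fun ν : Measure X => ν.real A) heq
    simpa [measureReal_def, Measure.restrict_apply hA] using this
  have : μ.real A = 0 ∨ μ.real A = 1 := by
    rcases eq_or_ne (μ.real A) 0 with h0 | h0
    · exact Or.inl h0
    · exact Or.inr (mul_left_cancel₀ h0 (by linarith))
  rw [eventuallyConst_set']
  rcases this with h0 | h1
  · left
    exact ae_eq_empty.2 ((measureReal_eq_zero_iff).1 h0)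
  · right
    rw [ae_eq_univ, prob_compl_eq_zero_iff hA]
    exact (ENNReal.toReal_eq_one_iff _).1 h1

end Criterion

/-! ### Periodic orbit measures -/

theorem continuous_shift : Continuous shift := continuous_pi fun n => continuous_apply (n + 1)

theorem shift_iterate_apply (n i : ℕ) (ω : Omega) : shift^[n] ω i = ω (i + n) := by
  induction n generalizing ω with
  | zero => rfl
  | succ n ih =>
    rw [Function.iterate_succ_apply, ih]
    simp only [shift]
    congr 1

/-- The uniform distribution on the points `ω, T ω, …, T^(N-1) ω`. -/
noncomputable def orbitMeasure (ω : Omega) (N : ℕ) [NeZero N] : ProbabilityMeasure Omega :=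
  ⟨(N : ENNReal)⁻¹ • ∑ i ∈ Finset.range N, Measure.dirac (shift^[i] ω), ⟨by
    simp [ENNReal.inv_mul_cancel (Nat.cast_ne_zero.2 (NeZero.ne N)) (ENNReal.natCast_ne_top N)]⟩⟩

theorem coe_orbitMeasure (ω : Omega) (N : ℕ) [NeZero N] : (orbitMeasure ω N : Measure Omega) =
    (N : ENNReal)⁻¹ • ∑ i ∈ Finset.range N, Measure.dirac (shift^[i] ω) := rfl

theorem orbitMeasure_real_apply (ω : Omega) (N : ℕ) [NeZero N] {B : Set Omega}
    (hB : MeasurableSet B) : (orbitMeasure ω N : Measure Omega).real B =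
      (N : ℝ)⁻¹ * ∑ i ∈ Finset.range N, B.indicator 1 (shift^[i] ω) := by
  rw [coe_orbitMeasure, measureReal_ennreal_smul_apply, measureReal_def, Measure.finsetSum_apply,
    ENNReal.toReal_sum (fun i _ => measure_ne_top _ _)]
  simp only [Measure.dirac_apply' _ hB, ENNReal.toReal_inv, ENNReal.toReal_natCast]
  congr 1
  refine Finset.sum_congr rfl fun i _ => ?_
  by_cases h : shift^[i] ω ∈ B <;> simp [h]

theorem ae_orbitMeasure {ω : Omega} {N : ℕ} [NeZero N] {p : Omega → Prop}
    (h : ∀ i, p (shift^[i] ω)) (hp : MeasurableSet {x | p x}) :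
    ∀ᵐ x ∂(orbitMeasure ω N : Measure Omega), p x := by
  rw [ae_iff]
  have h0 : (orbitMeasure ω N : Measure Omega).real {x | p x}ᶜ = 0 := by
    rw [orbitMeasure_real_apply _ _ hp.compl]
    simp [h]
  exact (measureReal_eq_zero_iff).1 h0

theorem measurePreserving_shift_orbitMeasure {ω : Omega} {N : ℕ} [NeZero N]
    (h : shift^[N] ω = ω) :
    MeasurePreserving shift (orbitMeasure ω N : Measure Omega) (orbitMeasure ω N) := by
  refine ⟨continuous_shift.measurable, Measure.ext fun B hB => ?_⟩
  rw [Measure.map_apply continuous_shift.measurable hB, ← measureReal_eq_measureReal_iff,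
    orbitMeasure_real_apply _ _ (continuous_shift.measurable hB), orbitMeasure_real_apply _ _ hB]
  congr 1
  have h1 : ∀ i, (shift ⁻¹' B).indicator (1 : Omega → ℝ) (shift^[i] ω) =
      B.indicator 1 (shift^[i + 1] ω) := fun i => by
    rw [Function.iterate_succ_apply']
    rfl
  simp only [h1]
  -- Split the sum over `range (N + 1)` at either end; the two end terms agree by periodicity.
  have h2 := Finset.sum_range_succ (fun i => B.indicator (1 : Omega → ℝ) (shift^[i] ω)) N
  rw [Finset.sum_range_succ', h] at h2
  exact add_right_cancel h2

theorem sum_range_orbit_add {ω : Omega} {N : ℕ} (h : shift^[N] ω = ω) (f : Omega → ℝ) (m : ℕ) :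
    ∑ i ∈ Finset.range (N * m), f (shift^[i] ω) = m * ∑ i ∈ Finset.range N, f (shift^[i] ω) := by
  induction m with
  | zero => simp
  | succ m ih =>
    have hNm : shift^[N * m] ω = ω := by
      rw [Function.iterate_mul]
      exact Function.iterate_fixed h m
    rw [Nat.mul_succ, Finset.sum_range_add, ih]
    push_cast
    have : ∀ i, shift^[N * m + i] ω = shift^[i] ω := fun i => by
      rw [add_comm, Function.iterate_add_apply, hNm]
    simp only [this]
    ring

theorem birkhoffAverage_orbit {ω : Omega} {N : ℕ} (h : shift^[N] ω = ω) (f : Omega → ℝ) (i : ℕ) :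
    birkhoffAverage ℝ shift f N (shift^[i] ω) = birkhoffAverage ℝ shift f N ω := by
  induction i with
  | zero => rfl
  | succ i ih =>
    rw [← ih, Function.iterate_succ_apply', ← sub_eq_zero,
      birkhoffAverage_apply_sub_birkhoffAverage, ← Function.iterate_add_apply, add_comm,
      Function.iterate_add_apply, h, sub_self, smul_zero]

/-- The average over a full period is constant along the orbit. -/
theorem variance_birkhoffAverage_orbitMeasure {ω : Omega} {N : ℕ} [NeZero N]
    (h : shift^[N] ω = ω) {f : Omega → ℝ} (hf : Measurable f) :
    Var[birkhoffAverage ℝ shift f N; (orbitMeasure ω N : Measure Omega)] = 0 := by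
  have hm : Measurable (birkhoffAverage ℝ shift f N) := by
    have : Measurable fun x => ∑ i ∈ Finset.range N, f (shift^[i] x) :=
      Finset.measurable_sum _ fun i _ => hf.comp (continuous_shift.measurable.iterate i)
    exact this.const_smul ((N : ℝ)⁻¹)
  have hae : birkhoffAverage ℝ shift f N =ᵐ[(orbitMeasure ω N : Measure Omega)]
      fun _ => birkhoffAverage ℝ shift f N ω :=
    ae_orbitMeasure (birkhoffAverage_orbit h f) (measurableSet_eq_fun hm measurable_const)
  rw [variance_congr hae]
  simp [variance_eq_integral aemeasurable_const]

theorem continuous_indicator_prefixSet (k : ℕ) (S : Set (Fin k → Bool)) :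
    Continuous ((prefixSet k S).indicator (1 : Omega → ℝ)) :=
  (IsClopen.continuous_indicator (isClopen_prefixSet k S) continuous_one)

theorem continuous_birkhoffAverage_shift {f : Omega → ℝ} (hf : Continuous f) (n : ℕ) :
    Continuous (birkhoffAverage ℝ shift f n) := by
  have : Continuous fun x => ∑ i ∈ Finset.range n, f (shift^[i] x) :=
    continuous_finsetSum _ fun i _ => hf.comp (continuous_shift.iterate i)
  exact this.const_smul ((n : ℝ)⁻¹)

theorem continuous_variance {f : Omega → ℝ} (hf : Continuous f) :
    Continuous fun P : ProbabilityMeasure Omega => Var[f; (P : Measure Omega)] := by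
  have h : ∀ P : ProbabilityMeasure Omega, Var[f; (P : Measure Omega)] =
      ∫ x, (f ^ 2) x ∂(P : Measure Omega) - (∫ x, f x ∂(P : Measure Omega)) ^ 2 := fun P =>
    variance_eq_sub (hf.memLp_of_hasCompactSupport (HasCompactSupport.of_compactSpace f))
  simp only [h]
  have h2 : ∀ g : C(Omega, ℝ), Continuous fun P : ProbabilityMeasure Omega =>
      ∫ x, g x ∂(P : Measure Omega) := fun g =>
    ProbabilityMeasure.continuous_integral_continuousMap g
  exact (h2 ⟨_, hf.pow 2⟩).sub ((h2 ⟨f, hf⟩).pow 2)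

theorem isClosed_setOf_measurePreserving_shift :
    IsClosed {P : ProbabilityMeasure Omega |
      MeasurePreserving shift (P : Measure Omega) (P : Measure Omega)} := by
  have h := isClosed_eq (ProbabilityMeasure.continuous_map continuous_shift) continuous_id
  convert h using 1
  ext P
  constructor
  · exact fun hP => Subtype.ext hP.map_eq
  · exact fun hP => ⟨continuous_shift.measurable, congrArg Subtype.val hP⟩

/-! ### Approximation of a nonergodic mixture by periodic orbit measures -/

/-- The periodic sequence with period `L` whose first `M` terms are those of `ω` and whose
next `L - M` terms are equal to `c`. -/
def padded (ω : Omega) (c : Bool) (M L : ℕ) : Omega :=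
  fun i => if i % L < M then ω (i % L) else c

theorem shift_iterate_padded (ω : Omega) (c : Bool) (M L : ℕ) :
    shift^[L] (padded ω c M L) = padded ω c M L := by
  ext i
  simp [shift_iterate_apply, padded]

theorem indicator_prefixSet_congr {k : ℕ} (S : Set (Fin k → Bool)) {ω ω' : Omega}
    (h : ∀ i < k, ω i = ω' i) :
    (prefixSet k S).indicator (1 : Omega → ℝ) ω = (prefixSet k S).indicator 1 ω' := by
  have : ω ∈ prefixSet k S ↔ ω' ∈ prefixSet k S :=
    ⟨mem_prefixSet_of_forall h, mem_prefixSet_of_forall fun i hi => (h i hi).symm⟩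
  by_cases hω : ω ∈ prefixSet k S
  · rw [indicator_of_mem hω, indicator_of_mem (this.1 hω)]; rfl
  · rw [indicator_of_notMem hω, indicator_of_notMem (mt this.2 hω)]

/-- A window of length `k` lying inside one block sees only `ω` or only `c`. At most `2k` starting
positions give a window crossing one of the two block ends, and each costs at most 1. -/
theorem abs_sum_padded_sub_le (ω : Omega) (c : Bool) (M r : ℕ) (k : ℕ) (S : Set (Fin k → Bool)) :
    |∑ i ∈ Finset.range (M + r),
        (prefixSet k S).indicator (1 : Omega → ℝ) (shift^[i] (padded ω c M (M + r))) -
      (∑ i ∈ Finset.range M, (prefixSet k S).indicator (1 : Omega → ℝ) (shift^[i] ω) +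
        r * (prefixSet k S).indicator (1 : Omega → ℝ) fun _ => c)| ≤ 2 * k := by
  set f : Omega → ℝ := (prefixSet k S).indicator 1 with hf
  have hf01 : ∀ x, 0 ≤ f x ∧ f x ≤ 1 := fun x => by
    by_cases hx : x ∈ prefixSet k S <;> simp [hf, hx]
  let v : ℕ → ℝ := fun i => if i < M then f (shift^[i] ω) else f fun _ => c
  have hv : ∑ i ∈ Finset.range (M + r), v i =
      ∑ i ∈ Finset.range M, f (shift^[i] ω) + r * f fun _ => c := by
    rw [Finset.sum_range_add]
    congr 1
    · exact Finset.sum_congr rfl fun i hi => if_pos (Finset.mem_range.1 hi)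
    · simp [v]
  rw [← hv, ← Finset.sum_sub_distrib]
  let bad : Finset ℕ := Finset.Ico (M - k) M ∪ Finset.Ico (M + r - k) (M + r)
  have hbad : (bad.card : ℝ) ≤ 2 * k := by
    have : bad.card ≤ 2 * k := by
      refine (Finset.card_union_le _ _).trans ?_
      simp only [Nat.card_Ico]
      omega
    exact_mod_cast this
  have hterm : ∀ i ∈ Finset.range (M + r),
      |f (shift^[i] (padded ω c M (M + r))) - v i| ≤ if i ∈ bad then 1 else 0 := by
    intro i hi
    rw [Finset.mem_range] at hi
    split_ifs with hb
    · have h1 := hf01 (shift^[i] (padded ω c M (M + r)))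
      have h2 : 0 ≤ v i ∧ v i ≤ 1 := by
        simp only [v]
        split_ifs <;> exact hf01 _
      exact abs_sub_le_iff.2 ⟨by linarith [h1.2, h2.1], by linarith [h1.1, h2.2]⟩
    · simp only [bad, Finset.mem_union, Finset.mem_Ico, not_or, not_and, not_lt] at hb
      refine (abs_eq_zero.2 (sub_eq_zero.2 ?_)).le
      simp only [v]
      split_ifs with hiM
      · refine indicator_prefixSet_congr S fun l hl => ?_
        have h1 : l + i < M := by omega
        simp only [shift_iterate_apply, padded]
        rw [Nat.mod_eq_of_lt (by omega), if_pos h1]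
      · refine indicator_prefixSet_congr S fun l hl => ?_
        simp only [shift_iterate_apply, padded]
        rw [Nat.mod_eq_of_lt (by omega), if_neg (by omega)]
  calc _ ≤ ∑ i ∈ Finset.range (M + r), |f (shift^[i] (padded ω c M (M + r))) - v i| :=
        Finset.abs_sum_le_sum_abs _ _
    _ ≤ ∑ i ∈ Finset.range (M + r), if i ∈ bad then (1 : ℝ) else 0 := Finset.sum_le_sum hterm
    _ ≤ bad.card := by
        rw [Finset.sum_ite_mem, Finset.sum_const, nsmul_eq_mul, mul_one]
        exact_mod_cast Finset.card_le_card Finset.inter_subset_right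
    _ ≤ 2 * k := hbad

/-- The mixture of `P` and the point mass at the constant sequence `c` with weights
`j / (j + 1)` and `1 / (j + 1)`. -/
noncomputable def mixture (P : ProbabilityMeasure Omega) (c : Bool) (j : ℕ) :
    ProbabilityMeasure Omega :=
  ⟨((j : ENNReal) + 1)⁻¹ • ((j : ENNReal) • (P : Measure Omega) + Measure.dirac fun _ => c), ⟨by
    simpa [mul_add] using
      ENNReal.inv_mul_cancel (a := (j : ENNReal) + 1) (by simp) (by finiteness)⟩⟩

theorem mixture_real_apply (P : ProbabilityMeasure Omega) (c : Bool) (j : ℕ) {B : Set Omega}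
    (hB : MeasurableSet B) : (mixture P c j : Measure Omega).real B =
      ((j : ℝ) + 1)⁻¹ * (j * (P : Measure Omega).real B + B.indicator 1 fun _ => c) := by
  have hd : (Measure.dirac (fun _ => c : Omega)).real B = B.indicator 1 fun _ => c := by
    rw [measureReal_def, Measure.dirac_apply' _ hB]
    by_cases h : (fun _ => c : Omega) ∈ B <;> simp [h]
  have hj : ((j : ENNReal) + 1).toReal = (j : ℝ) + 1 := by
    rw [ENNReal.toReal_add (by finiteness) (by finiteness)]
    simp
  change (((j : ENNReal) + 1)⁻¹ •
    ((j : ENNReal) • (P : Measure Omega) + Measure.dirac fun _ => c)).real B = _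
  rw [measureReal_ennreal_smul_apply, ENNReal.toReal_inv, hj, measureReal_add_apply
    (by simp [ENNReal.mul_ne_top]) (by finiteness),
    measureReal_ennreal_smul_apply, hd, ENNReal.toReal_natCast]

theorem tendsto_mixture (P : ProbabilityMeasure Omega) (c : Bool) :
    Tendsto (mixture P c) atTop (𝓝 P) := by
  refine tendsto_of_forall_prefixSet fun k S => ?_
  set a := (P : Measure Omega).real (prefixSet k S)
  set b := (prefixSet k S).indicator (1 : Omega → ℝ) fun _ => c
  have h : ∀ j : ℕ, (mixture P c j : Measure Omega).real (prefixSet k S) =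
      a + (b - a) * (1 / ((j : ℝ) + 1)) := fun j => by
    rw [mixture_real_apply _ _ _ (measurableSet_prefixSet k S)]
    have : (j : ℝ) + 1 ≠ 0 := by positivity
    field_simp
    ring
  simp only [h]
  have := (tendsto_one_div_add_atTop_nhds_zero_nat (𝕜 := ℝ)).const_mul (b - a)
  simpa using this.const_add a

/-- The new period consists of `(m + 1) * j` old periods followed by `N * (m + 1)` copies of `c`, so
the block lengths are exactly in the ratio `j : 1` of the mixture weights. Only the boundary error
remains, at most `2k / (N (m + 1) (j + 1))`. -/
theorem tendsto_orbitMeasure_padded {ω : Omega} {N : ℕ} [NeZero N] (h : shift^[N] ω = ω)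
    (c : Bool) (j : ℕ) :
    Tendsto (fun m : ℕ => haveI : NeZero (N * ((m + 1) * j) + N * (m + 1)) :=
        ⟨by have := NeZero.ne N; positivity⟩
      orbitMeasure (padded ω c (N * ((m + 1) * j)) (N * ((m + 1) * j) + N * (m + 1)))
        (N * ((m + 1) * j) + N * (m + 1))) atTop (𝓝 (mixture (orbitMeasure ω N) c j)) := by
  refine tendsto_of_forall_prefixSet fun k S => ?_
  have hN : (0 : ℝ) < N := Nat.cast_pos.2 (Nat.pos_of_ne_zero (NeZero.ne N))
  rw [tendsto_iff_dist_tendsto_zero]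
  have hlim := (tendsto_one_div_add_atTop_nhds_zero_nat (𝕜 := ℝ)).const_mul (2 * (k : ℝ) / (N * (j + 1)))
  rw [mul_zero] at hlim
  refine squeeze_zero (fun _ => dist_nonneg) (fun m => ?_) hlim
  rw [Real.dist_eq, mixture_real_apply _ _ _ (measurableSet_prefixSet k S),
    orbitMeasure_real_apply _ _ (measurableSet_prefixSet k S),
    orbitMeasure_real_apply _ _ (measurableSet_prefixSet k S)]
  have hle := abs_sum_padded_sub_le ω c (N * ((m + 1) * j)) (N * (m + 1)) k S
  rw [sum_range_orbit_add h] at hle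
  set x := ∑ i ∈ Finset.range (N * ((m + 1) * j) + N * (m + 1)),
    (prefixSet k S).indicator (1 : Omega → ℝ) (shift^[i]
      (padded ω c (N * ((m + 1) * j)) (N * ((m + 1) * j) + N * (m + 1))))
  set y := ∑ i ∈ Finset.range N, (prefixSet k S).indicator (1 : Omega → ℝ) (shift^[i] ω)
  set z := (prefixSet k S).indicator (1 : Omega → ℝ) fun _ => c
  have hL : (0 : ℝ) < N * (m + 1) * (j + 1) := by positivity
  have heq : ((N * ((m + 1) * j) + N * (m + 1) : ℕ) : ℝ)⁻¹ * x -
      ((j : ℝ) + 1)⁻¹ * (j * ((N : ℝ)⁻¹ * y) + z) =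
      (x - (((m + 1) * j : ℕ) * y + (N * (m + 1) : ℕ) * z)) / (N * (m + 1) * (j + 1)) := by
    push_cast
    have h1 : (N : ℝ) * ((m + 1) * j) + N * (m + 1) = N * (m + 1) * (j + 1) := by ring
    rw [h1]
    field_simp
  rw [heq, abs_div, abs_of_pos hL, div_le_iff₀ hL]
  refine hle.trans_eq ?_
  field_simp

theorem not_ergodic_mixture {ω : Omega} {N : ℕ} [NeZero N] (h : shift^[N] ω = ω) {j : ℕ}
    (hj : j ≠ 0) :
    ¬ Ergodic shift (mixture (orbitMeasure ω N) (!ω 0) j : Measure Omega) := by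
  intro he
  -- This invariant set contains the constant sequence but misses the orbit, where the value `ω 0`
  -- recurs; its measure `1 / (j + 1)` is neither 0 nor 1.
  let A : Set Omega := {x | ∀ᶠ i in atTop, x i = !ω 0}
  have hA : MeasurableSet A := by
    have : A = ⋃ n, ⋂ i ≥ n, (fun x : Omega => x i) ⁻¹' {!ω 0} := by
      ext x
      simp [A, eventually_atTop]
    rw [this]
    exact .iUnion fun n => .iInter fun i => .iInter fun _ =>
      measurable_pi_apply i (measurableSet_singleton _)
  have hshift : ∀ x : Omega, shift x ∈ A ↔ x ∈ A := fun x => by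
    change (∀ᶠ i in atTop, x (i + 1) = !ω 0) ↔ ∀ᶠ i in atTop, x i = !ω 0
    conv_rhs => rw [← map_add_atTop_eq_nat 1]
    rfl
  have hω : ω ∉ A := fun hω => by
    obtain ⟨n, hn⟩ := eventually_atTop.1 hω
    have h1 : ω (N * n) = ω 0 := by
      have : shift^[N * n] ω = ω := by
        rw [Function.iterate_mul]
        exact Function.iterate_fixed h n
      simpa [shift_iterate_apply] using congrFun this 0
    have h2 := hn (N * n) (Nat.le_mul_of_pos_left n (Nat.pos_of_ne_zero (NeZero.ne N)))
    rw [h1] at h2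
    simp at h2
  have horbit : ∀ i, shift^[i] ω ∉ A := fun i => by
    induction i with
    | zero => exact hω
    | succ i ih => rwa [Function.iterate_succ_apply', hshift]
  have hval : (mixture (orbitMeasure ω N) (!ω 0) j : Measure Omega).real A =
      ((j : ℝ) + 1)⁻¹ := by
    rw [mixture_real_apply _ _ _ hA, orbitMeasure_real_apply _ _ hA]
    have hc : (fun _ => !ω 0 : Omega) ∈ A := Eventually.of_forall fun _ => rfl
    simp [horbit, hc]
  have hj' : (0 : ℝ) < j := Nat.cast_pos.2 (Nat.pos_of_ne_zero hj)
  rcases he.toPreErgodic.prob_eq_zero_or_one hA (Set.ext hshift) with h0 | h1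
  · rw [measureReal_def, h0] at hval
    have : (0 : ℝ) < ((j : ℝ) + 1)⁻¹ := by positivity
    simp at hval
    linarith
  · rw [measureReal_def, h1, ENNReal.toReal_one, eq_comm, inv_eq_one] at hval
    linarith

/-! ### The closure of the set of periodic orbit measures -/

/-- The set of all measures that are uniformly distributed on a periodic orbit of the shift. -/
def periodicMeasures : Set (ProbabilityMeasure Omega) :=
  {P | ∃ (ω : Omega) (N : ℕ) (_ : NeZero N), shift^[N] ω = ω ∧ P = orbitMeasure ω N}

theorem mixture_mem_closure_periodicMeasures {ω : Omega} {N : ℕ} [NeZero N]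
    (h : shift^[N] ω = ω) (c : Bool) (j : ℕ) :
    mixture (orbitMeasure ω N) c j ∈ closure periodicMeasures :=
  mem_closure_of_tendsto (tendsto_orbitMeasure_padded h c j) <| Eventually.of_forall fun _ =>
    ⟨_, _, _, shift_iterate_padded _ _ _ _, rfl⟩

theorem periodicMeasures_subset_closure_diff {C : Set (ProbabilityMeasure Omega)}
    (hC : ∀ Q ∈ C, Ergodic shift (Q : Measure Omega)) :
    periodicMeasures ⊆ closure (closure periodicMeasures \ C) := by
  rintro _ ⟨ω, N, _, h, rfl⟩
  refine mem_closure_of_tendsto (tendsto_mixture (orbitMeasure ω N) (!ω 0)) ?_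
  filter_upwards [eventually_ne_atTop 0] with j hj
  exact ⟨mixture_mem_closure_periodicMeasures h _ _, fun hmem => not_ergodic_mixture h hj (hC _ hmem)⟩

/-- The measures for which some Birkhoff average of the indicator of `prefixSet k S` has
variance less than `ε`. -/
def smallVariance (k : ℕ) (S : Set (Fin k → Bool)) (ε : ℝ) : Set (ProbabilityMeasure Omega) :=
  {P | ∃ n ≠ 0, Var[birkhoffAverage ℝ shift ((prefixSet k S).indicator 1) n;
    (P : Measure Omega)] < ε}

theorem isOpen_smallVariance (k : ℕ) (S : Set (Fin k → Bool)) (ε : ℝ) :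
    IsOpen (smallVariance k S ε) := by
  have : smallVariance k S ε = ⋃ n ≠ 0, {P : ProbabilityMeasure Omega |
      Var[birkhoffAverage ℝ shift ((prefixSet k S).indicator 1) n; (P : Measure Omega)] < ε} := by
    ext P
    simp [smallVariance]
  rw [this]
  exact isOpen_biUnion fun n _ => isOpen_lt (continuous_variance
    (continuous_birkhoffAverage_shift (continuous_indicator_prefixSet k S) n)) continuous_const

theorem periodicMeasures_subset_smallVariance (k : ℕ) (S : Set (Fin k → Bool)) {ε : ℝ}
    (hε : 0 < ε) : periodicMeasures ⊆ smallVariance k S ε := by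
  rintro _ ⟨ω, N, _, h, rfl⟩
  refine ⟨N, NeZero.ne N, ?_⟩
  rwa [variance_birkhoffAverage_orbitMeasure h (continuous_indicator_prefixSet k S).measurable]

theorem ergodic_of_mem_closure_periodicMeasures {P : ProbabilityMeasure Omega}
    (hP : P ∈ closure periodicMeasures)
    (h : ∀ k S (m : ℕ), P ∈ smallVariance k S (1 / ((m : ℝ) + 1))) :
    Ergodic shift (P : Measure Omega) := by
  have hinv : MeasurePreserving shift (P : Measure Omega) P := by
    refine closure_minimal ?_ isClosed_setOf_measurePreserving_shift hP
    rintro _ ⟨ω, N, _, h, rfl⟩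
    exact measurePreserving_shift_orbitMeasure h
  refine ergodic_of_forall_exists_variance_lt hinv generateFrom_prefixSets
    isPiSystem_prefixSets ?_
  rintro _ ⟨k, S, rfl⟩ ε hε
  obtain ⟨m, hm⟩ := exists_nat_one_div_lt hε
  obtain ⟨n, hn, hlt⟩ := h k S m
  exact ⟨n, hn, hlt.trans hm⟩

theorem exists_ergodic_forall_notMem {𝒞 : Set (Set (ProbabilityMeasure Omega))}
    (hcount : 𝒞.Countable) (hclosed : ∀ C ∈ 𝒞, IsClosed C)
    (herg : ∀ C ∈ 𝒞, ∀ Q ∈ C, Ergodic shift (Q : Measure Omega)) :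
    ∃ P : ProbabilityMeasure Omega, Ergodic shift (P : Measure Omega) ∧ ∀ C ∈ 𝒞, P ∉ C := by
  let K : Set (ProbabilityMeasure Omega) := closure periodicMeasures
  have : CompactSpace K := isCompact_iff_compactSpace.1 isClosed_closure.isCompact
  have : Countable 𝒞 := hcount.to_subtype
  have : Nonempty K := ⟨⟨orbitMeasure (fun _ => false) 1,
    subset_closure ⟨_, 1, inferInstance, rfl, rfl⟩⟩⟩
  -- The index type is countable because each `Set (Fin k → Bool)` is finite.
  let V : ((Σ k : ℕ, Set (Fin k → Bool)) × ℕ) ⊕ 𝒞 → Set (ProbabilityMeasure Omega) :=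
    Sum.elim (fun p => smallVariance p.1.1 p.1.2 (1 / ((p.2 : ℝ) + 1))) fun C => C.1ᶜ
  have hVo : ∀ i, IsOpen (V i) := by
    rintro (p | C)
    · exact isOpen_smallVariance _ _ _
    · exact (hclosed C C.2).isOpen_compl
  have hVd : ∀ i, periodicMeasures ⊆ closure (K ∩ V i) := by
    rintro (p | C)
    · exact fun P hP => subset_closure ⟨subset_closure hP,
        periodicMeasures_subset_smallVariance _ _ (by positivity) hP⟩
    · exact periodicMeasures_subset_closure_diff (herg C C.2)
  obtain ⟨⟨P, hPK⟩, hP⟩ := (dense_iInter_of_isOpen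
    (f := fun i => ((↑) : K → ProbabilityMeasure Omega) ⁻¹' V i)
    (fun i => (hVo i).preimage continuous_subtype_val) fun i => by
      -- Density in `K` only has to be checked at periodic orbit measures, since `K` is their
      -- closure.
      rw [Subtype.dense_iff, Subtype.image_preimage_coe]
      exact closure_minimal (hVd i) isClosed_closure).nonempty
  rw [mem_iInter] at hP
  exact ⟨P, ergodic_of_mem_closure_periodicMeasures hPK fun k S m => hP (Sum.inl (⟨k, S⟩, m)),
    fun C hC => hP (Sum.inr ⟨C, hC⟩)⟩

end BinarySequence

theorem mainTheorem11 :
    ∃ P : ProbabilityMeasure BinarySequence.Omega,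
      Ergodic BinarySequence.shift (P : Measure BinarySequence.Omega) ∧
      ∀ C : Set (ProbabilityMeasure BinarySequence.Omega),
        BinarySequence.IsEffectivelyCompact C →
        (∀ Q ∈ C, Ergodic BinarySequence.shift (Q : Measure BinarySequence.Omega)) →
        P ∉ C := by
  obtain ⟨P, hP, hPC⟩ := BinarySequence.exists_ergodic_forall_notMem
    (𝒞 := {C | BinarySequence.IsEffectivelyCompact C ∧
      ∀ Q ∈ C, Ergodic BinarySequence.shift (Q : Measure BinarySequence.Omega)})
    (BinarySequence.countable_setOf_isEffectivelyCompact.mono fun _ h => h.1)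
    (fun _ h => h.1.1.isClosed) fun _ h => h.2
  exact ⟨P, hP, fun C hC hCE => hPC C ⟨hC, hCE⟩⟩
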